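/- All graphs are finite and simple. For a natural number $k$, a graph $G$ is $k$-vertex-critical if its chromatic number satisfies $\chi(G)=k$ and $\chi(G-v)<k$ for every vertex $v$ of $G$. For graphs $H_1,H_2$, a graph is $(H_1,H_2)$-free if none of its induced subgraphs is isomorphic to $H_1$ or to $H_2$. The co-gem is the disjoint union $P_4+P_1$ of a path on four vertices and a single vertex; the paw is the graph on four vertices consisting of a triangle and a fourth vertex adjacent to exactly one vertex of the triangle; and $\text{paw}+P_1$ is the disjoint union of the paw and a single vertex. **Theorem 4.1.** For every $k$ there are, up to isomorphism, only finitely many $k$-vertex-critical $(\text{co-gem},\ \text{paw}+P_1)$-free graphs. -/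

import Mathlib

/-- `G` is `k`-vertex-critical: its chromatic number is `k`, and deleting any single vertex gives
a graph of chromatic number smaller than `k`. -/
def IsVertexCritical {V : Type*} (G : SimpleGraph V) (k : ℕ) : Prop :=
  G.chromaticNumber = (k : ℕ∞) ∧
    ∀ v : V, (G.induce ({v}ᶜ : Set V)).chromaticNumber < (k : ℕ∞)

/-- `G` is `H`-free: no induced subgraph of `G` is isomorphic to `H`. -/
def IsIndFree {V W : Type*} (H : SimpleGraph W) (G : SimpleGraph V) : Prop :=
  ¬ SimpleGraph.IsIndContained H G

/-- The co-gem, that is, the disjoint union of a path on four vertices and a single vertex. -/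
def coGem : SimpleGraph (Fin 4 ⊕ Fin 1) :=
  SimpleGraph.pathGraph 4 ⊕g SimpleGraph.pathGraph 1

/-- The paw: the triangle `0, 1, 2` together with the vertex `3`, which is adjacent to `2` only. -/
def paw : SimpleGraph (Fin 4) :=
  SimpleGraph.fromEdgeSet {s(0, 1), s(1, 2), s(0, 2), s(2, 3)}

/-- The disjoint union of the paw and a single vertex. -/
def pawPlusPoint : SimpleGraph (Fin 4 ⊕ Fin 1) :=
  paw ⊕g SimpleGraph.pathGraph 1

/-!
Trace every vertex on a fixed maximal independent set `S`. If the traces of two vertices do not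
cover `S`, then freeness makes them equal or disjoint. In a critical graph no neighbourhood contains
another, so the traces also separate the points of `S`, and a family of nonempty sets with these two
properties either consists of sets missing at most one point or consists of singletons and `S`.

In the first case, colour `G - v` for some `v ∈ S` with `k - 1` colours. Each colour appears on a
neighbour of `v`, and this neighbour is adjacent to all but at most one vertex of `S`, so the
vertices of `S` other than `v` have distinct colours and `|S| ≤ k`.

In the second case, if `|S| ≥ 3`, then a vertex `s ∈ S` and the vertices with trace `{s}` form a
module, and all these modules have the same neighbourhood: the vertices with full trace. But a
vertex-critical graph has no two disjoint modules with the same neighbourhood `F`. Indeed, delete a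
vertex from each and colour both remaining graphs; the colouring which leaves at least as many
colours free on `F` provides one for the module destroyed in the other. Hence `|S| ≤ 2`.

Colour classes being independent, `G` has at most `k * max k 2` vertices.
-/

section CriticalGraphs

variable {V : Type*} {G : SimpleGraph V} {k : ℕ}

section ForbiddenSubgraphs

lemma isIndContained_of_adj_iff {W : Type*} {H : SimpleGraph W}
    (hH : Function.Injective H.neighborSet) {f : W → V}
    (hf : ∀ i j, G.Adj (f i) (f j) ↔ H.Adj i j) : H.IsIndContained G := by
  refine ⟨⟨⟨f, fun i j hij => hH (Set.ext fun l => ?_)⟩, hf _ _⟩⟩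
  rw [SimpleGraph.mem_neighborSet, SimpleGraph.mem_neighborSet, ← hf, hij, hf]

lemma coGem_neighborSet_injective : Function.Injective coGem.neighborSet := by
  simp [Function.Injective, Set.ext_iff, coGem, SimpleGraph.pathGraph_adj, Fin.forall_fin_succ]

lemma pawPlusPoint_neighborSet_injective : Function.Injective pawPlusPoint.neighborSet := by
  simp [Function.Injective, Set.ext_iff, pawPlusPoint, paw, Fin.forall_fin_succ]

lemma coGem_isIndContained {a b c d e : V}
    (hab : G.Adj a b) (hbc : G.Adj b c) (hcd : G.Adj c d)
    (hac : ¬ G.Adj a c) (had : ¬ G.Adj a d) (hbd : ¬ G.Adj b d)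
    (hae : ¬ G.Adj a e) (hbe : ¬ G.Adj b e) (hce : ¬ G.Adj c e) (hde : ¬ G.Adj d e) :
    coGem.IsIndContained G := by
  refine isIndContained_of_adj_iff coGem_neighborSet_injective
    (f := Sum.elim ![a, b, c, d] ![e]) ?_
  rintro (i | i) (j | j) <;> fin_cases i <;> fin_cases j <;>
    simp [coGem, SimpleGraph.pathGraph_adj] <;> grind [SimpleGraph.adj_comm]

lemma pawPlusPoint_isIndContained {a b c d e : V}
    (hab : G.Adj a b) (hbc : G.Adj b c) (hac : G.Adj a c) (hcd : G.Adj c d)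
    (had : ¬ G.Adj a d) (hbd : ¬ G.Adj b d)
    (hae : ¬ G.Adj a e) (hbe : ¬ G.Adj b e) (hce : ¬ G.Adj c e) (hde : ¬ G.Adj d e) :
    pawPlusPoint.IsIndContained G := by
  refine isIndContained_of_adj_iff pawPlusPoint_neighborSet_injective
    (f := Sum.elim ![a, b, c, d] ![e]) ?_
  rintro (i | i) (j | j) <;> fin_cases i <;> fin_cases j <;>
    simp [pawPlusPoint, paw] <;> grind [SimpleGraph.adj_comm]

end ForbiddenSubgraphs

section Traces

/-- The trace on `S` of the vertex `x`: the neighbours of `x` in `S`, as a subset of the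
subtype `S`. -/
def trace (G : SimpleGraph V) (S : Set V) (x : V) : Set S :=
  {s | G.Adj x s}

variable {S : Set V}

lemma not_adj_of_isIndepSet (hS : G.IsIndepSet S) (s t : S) : ¬ G.Adj s t :=
  fun hst => hS s.2 t.2 hst.ne hst

lemma trace_nonempty_of_maximal (hS : Maximal G.IsIndepSet S) {x : V} (hx : x ∉ S) :
    (trace G S x).Nonempty := by
  by_contra hempty
  have hxS : ∀ s ∈ S, ¬ G.Adj x s := fun s hs hxs => hempty ⟨⟨s, hs⟩, hxs⟩
  exact hx (hS.mem_of_prop_insert (hS.prop.insert fun s hs _ =>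
    ⟨hxS s hs, fun hsx => hxS s hs hsx.symm⟩))

lemma exists_isIndepSet_subset_maximal (hS : G.IsIndepSet S) :
    ∃ T, S ⊆ T ∧ Maximal G.IsIndepSet T :=
  zorn_subset_nonempty {T | G.IsIndepSet T}
    (fun c hc hchain _ => ⟨⋃₀ c, (Set.pairwise_sUnion hchain.directedOn).2 hc,
      fun _ => Set.subset_sUnion_of_mem⟩) S hS

lemma trace_subset_of_inter_nonempty (h₁ : IsIndFree coGem G) (h₂ : IsIndFree pawPlusPoint G)
    (hS : G.IsIndepSet S) {x y : V} (hmeet : (trace G S x ∩ trace G S y).Nonempty)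
    (hmiss : trace G S x ∪ trace G S y ≠ Set.univ) : trace G S x ⊆ trace G S y := by
  have hindep := not_adj_of_isIndepSet hS
  obtain ⟨a, hxa : G.Adj x a, hya : G.Adj y a⟩ := hmeet
  obtain ⟨s, hs⟩ := (Set.ne_univ_iff_exists_notMem _).1 hmiss
  obtain ⟨hxs : ¬ G.Adj x s, hys : ¬ G.Adj y s⟩ := not_or.1 hs
  intro b (hxb : G.Adj x b)
  by_contra hyb
  by_cases hxy : G.Adj x y
  · exact h₂ (pawPlusPoint_isIndContained hya.symm hxy.symm hxa.symm hxb (hindep a b) hyb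
      (hindep a s) hys hxs (hindep b s))
  · exact h₁ (coGem_isIndContained hxb.symm hxa hya.symm (hindep b a) (fun h => hyb h.symm) hxy
      (hindep b s) hxs (hindep a s) hys)

lemma trace_eq_or_disjoint (h₁ : IsIndFree coGem G) (h₂ : IsIndFree pawPlusPoint G)
    (hS : G.IsIndepSet S) {x y : V} (hmiss : trace G S x ∪ trace G S y ≠ Set.univ) :
    trace G S x = trace G S y ∨ Disjoint (trace G S x) (trace G S y) := by
  refine or_iff_not_imp_right.2 fun hmeet => ?_
  rw [Set.not_disjoint_iff_nonempty_inter] at hmeet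
  exact (trace_subset_of_inter_nonempty h₁ h₂ hS hmeet hmiss).antisymm
    (trace_subset_of_inter_nonempty h₁ h₂ hS (Set.inter_comm _ _ ▸ hmeet)
      (Set.union_comm _ _ ▸ hmiss))

lemma eq_or_disjoint_of_not_subsingleton_compl {α : Type*} {𝒯 : Set (Set α)}
    (hsep : ∀ s t, s ≠ t → ∃ A ∈ 𝒯, s ∈ A ∧ t ∉ A)
    (hcross : ∀ A ∈ 𝒯, ∀ B ∈ 𝒯, A ∪ B ≠ Set.univ → A = B ∨ Disjoint A B) {A C : Set α}
    (hA : A ∈ 𝒯) (hAc : ¬ Aᶜ.Subsingleton) (hC : C ∈ 𝒯) (hCuniv : C ≠ Set.univ) :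
    A = C ∨ Disjoint A C := by
  obtain ⟨s, hs : s ∉ A, t, ht : t ∉ A, hst⟩ := Set.not_subsingleton_iff.1 hAc
  refine hcross A hA C hC fun hAC => ?_
  have hsC : s ∈ C := (hAC.ge (Set.mem_univ s)).resolve_left hs
  have htC : t ∈ C := (hAC.ge (Set.mem_univ t)).resolve_left ht
  obtain ⟨D, hD, hsD, htD⟩ := hsep s t hst
  have hAD : Disjoint A D :=
    (hcross A hA D hD fun h => (h.ge (Set.mem_univ t)).elim ht htD).resolve_left
      fun h => hs (h ▸ hsD)
  have hCD : C ∪ D = Set.univ := by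
    by_contra hCD
    rcases hcross C hC D hD hCD with rfl | hdisj
    · exact htD htC
    · exact Set.disjoint_left.1 hdisj hsC hsD
  have hAC' : A ⊆ C := fun a ha =>
    (hCD.ge (Set.mem_univ a)).resolve_right (Set.disjoint_left.1 hAD ha)
  exact hCuniv (Set.union_eq_right.2 hAC' ▸ hAC)

lemma forall_subsingleton_compl_or_forall_eq_univ_or_singleton {α : Type*} {𝒯 : Set (Set α)}
    (hne : ∀ A ∈ 𝒯, A.Nonempty)
    (hsep : ∀ s t, s ≠ t → ∃ A ∈ 𝒯, s ∈ A ∧ t ∉ A)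
    (hcross : ∀ A ∈ 𝒯, ∀ B ∈ 𝒯, A ∪ B ≠ Set.univ → A = B ∨ Disjoint A B) :
    (∀ A ∈ 𝒯, Aᶜ.Subsingleton) ∨ ∀ A ∈ 𝒯, A = Set.univ ∨ ∃ s, A = {s} := by
  by_contra! ⟨⟨A, hA, hAc⟩, B, hB, hBuniv, hBsing⟩
  have eq_or_disjoint := fun C => eq_or_disjoint_of_not_subsingleton_compl hsep hcross hA
    (Set.not_subsingleton_iff.2 hAc) (C := C)
  obtain ⟨b, hb⟩ := hne B hB
  obtain ⟨c, hc, hcb⟩ : ∃ c ∈ B, c ≠ b := by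
    by_contra! h
    exact hBsing b (Set.eq_singleton_iff_unique_mem.2 ⟨hb, h⟩)
  obtain ⟨C, hC, hbC, hcC⟩ := hsep b c hcb.symm
  have hCuniv : C ≠ Set.univ := fun h => hcC (h ▸ Set.mem_univ c)
  have hBC : ¬ (B = C ∨ Disjoint B C) := by
    rintro (rfl | h)
    · exact hcC hc
    · exact Set.disjoint_left.1 h hb hbC
  obtain ⟨a, ha⟩ := hne A hA
  rcases eq_or_disjoint B hB hBuniv with rfl | hAB
  · exact hBC (eq_or_disjoint C hC hCuniv)
  rcases eq_or_disjoint C hC hCuniv with rfl | hAC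
  · exact hBC (.inr hAB.symm)
  · exact hBC (hcross B hB C hC fun h => (h.ge (Set.mem_univ a)).elim
      (Set.disjoint_left.1 hAB ha) (Set.disjoint_left.1 hAC ha))

end Traces

section Colorings

variable {α : Type*} {A F : Set V}

lemma nonempty_coloring_of_compl (c : (G.induce Aᶜ).Coloring α) (d : (G.induce A).Coloring α)
    (hcd : ∀ (a : A) (v : (Aᶜ : Set V)), G.Adj a v → d a ≠ c v) :
    Nonempty (G.Coloring α) := by
  classical
  refine ⟨SimpleGraph.Coloring.mk
    (fun v => if hv : v ∈ A then d ⟨v, hv⟩ else c ⟨v, hv⟩) fun {u v} huv => ?_⟩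
  by_cases hu : u ∈ A <;> by_cases hv : v ∈ A <;> simp only [hu, hv, ↓reduceDIte]
  · exact d.valid huv
  · exact hcd _ _ huv
  · exact (hcd _ _ huv.symm).symm
  · exact c.valid huv

/-- `A` is a module of `G` (a set whose members have the same neighbours outside it), and `F` is
the common neighbourhood of its members outside `A`. -/
def IsModuleWith (G : SimpleGraph V) (A F : Set V) : Prop :=
  ∀ a ∈ A, G.neighborSet a \ A = F

lemma IsModuleWith.disjoint (hA : IsModuleWith G A F) (hne : A.Nonempty) : Disjoint A F := by
  obtain ⟨a, ha⟩ := hne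
  exact hA a ha ▸ Set.disjoint_sdiff_right

lemma IsModuleWith.nonempty_coloring (hA : IsModuleWith G A F) {P Q : Set V}
    (hP : Aᶜ ⊆ P) (hQ : A ∪ F ⊆ Q) (c : (G.induce P).Coloring α) (d : (G.induce Q).Coloring α)
    (e : ↥(d '' {u | ↑u ∈ F})ᶜ ↪ ↥(c '' {u | ↑u ∈ F})ᶜ) : Nonempty (G.Coloring α) := by
  have hfree : ∀ a : A, d ⟨a, hQ (.inl a.2)⟩ ∈ (d '' {u | ↑u ∈ F})ᶜ := by
    rintro a ⟨f, hf, hfa⟩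
    have haf : G.Adj a f := ((hA a a.2).ge hf).1
    exact d.valid (v := ⟨a, hQ (.inl a.2)⟩) (w := f) haf hfa.symm
  -- `A` is recoloured by moving the colours that `d` leaves free on `F` to colours that `c` leaves
  -- free on `F`.
  refine nonempty_coloring_of_compl (A := A)
    (c.comp (G.induceHomOfLE hP).toHom)
    (SimpleGraph.Coloring.mk (fun a => e ⟨_, hfree a⟩) fun {a b} hab heq => ?_)
    fun a v hav heq => ?_
  · exact d.valid (v := ⟨a, hQ (.inl a.2)⟩) (w := ⟨b, hQ (.inl b.2)⟩) hab
      (congrArg Subtype.val (e.injective (Subtype.ext heq)))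
  · refine (e ⟨_, hfree a⟩).2 ⟨⟨v, hP v.2⟩, ?_, heq.symm⟩
    exact (hA a a.2).le ⟨hav, v.2⟩

end Colorings

namespace IsVertexCritical

lemma colorable (h : IsVertexCritical G k) : G.Colorable k :=
  SimpleGraph.chromaticNumber_le_iff_colorable.1 h.1.le

lemma ne_zero (h : IsVertexCritical G k) (v : V) : k ≠ 0 := by
  rintro rfl
  exact not_lt_zero (h.2 v)

lemma not_colorable (h : IsVertexCritical G k) (v : V) : ¬ G.Colorable (k - 1) := by
  rw [← SimpleGraph.chromaticNumber_le_iff_colorable, h.1, Nat.cast_le]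
  have := h.ne_zero v
  lia

lemma colorable_induce_compl_singleton (h : IsVertexCritical G k) (v : V) :
    (G.induce ({v}ᶜ : Set V)).Colorable (k - 1) := by
  rw [← SimpleGraph.chromaticNumber_le_iff_colorable, ← ENat.lt_natCast_add_one_iff]
  exact_mod_cast Nat.sub_one_add_one (h.ne_zero v) ▸ h.2 v

lemma exists_adj_color_eq (h : IsVertexCritical G k) {v : V}
    (c : (G.induce ({v}ᶜ : Set V)).Coloring (Fin (k - 1))) (i : Fin (k - 1)) :
    ∃ u : ({v}ᶜ : Set V), G.Adj v u ∧ c u = i := by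
  by_contra! hi
  refine h.not_colorable v (nonempty_coloring_of_compl c
    (SimpleGraph.Coloring.mk (fun _ => i) fun {a b} hab => ?_) ?_)
  · exact (hab.ne (Subsingleton.elim a b)).elim
  · rintro ⟨a, rfl⟩ u hau
    exact (hi u hau).symm

lemma exists_adj_not_adj (h : IsVertexCritical G k) {s t : V} (hst : s ≠ t) :
    ∃ x, G.Adj x s ∧ ¬ G.Adj x t := by
  obtain ⟨c⟩ := h.colorable_induce_compl_singleton s
  obtain ⟨x, hsx, hcx⟩ := h.exists_adj_color_eq c (c ⟨t, hst.symm⟩)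
  exact ⟨x, hsx.symm, fun hxt => c.valid (v := x) (w := ⟨t, hst.symm⟩) hxt hcx⟩

lemma encard_le_of_subsingleton_compl_trace (h : IsVertexCritical G k) {S : Set V}
    (hS : G.IsIndepSet S) (hco : ∀ x ∉ S, (trace G S x)ᶜ.Subsingleton) : S.encard ≤ k := by
  obtain rfl | ⟨v, hv⟩ := S.eq_empty_or_nonempty
  · simp
  obtain ⟨c⟩ := h.colorable_induce_compl_singleton v
  have hinj : Function.Injective fun s : ↥(S \ {v}) => c ⟨s, s.2.2⟩ := by
    intro a b hab
    obtain ⟨u, hvu, hcu⟩ := h.exists_adj_color_eq c (c ⟨a, a.2.2⟩)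
    have huS : ↑u ∉ S := fun hu => hS hv hu hvu.ne hvu
    have hua : ¬ G.Adj u a := fun hua => c.valid (v := u) (w := ⟨a, a.2.2⟩) hua hcu
    have hub : ¬ G.Adj u b := fun hub =>
      c.valid (v := u) (w := ⟨b, b.2.2⟩) hub (hcu.trans hab)
    exact Subtype.ext (Subtype.mk.inj (@hco u huS ⟨a, a.2.1⟩ hua ⟨b, b.2.1⟩ hub))
  calc S.encard = (S \ {v}).encard + 1 := (Set.encard_sdiff_singleton_add_one hv).symm
    _ ≤ ((k - 1 : ℕ) : ℕ∞) + 1 := by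
      gcongr
      simpa using ENat.card_le_card_of_injective hinj
    _ = k := by exact_mod_cast Nat.sub_one_add_one (h.ne_zero v)

lemma not_disjoint_of_isModuleWith (h : IsVertexCritical G k) {A B F : Set V}
    (hA : IsModuleWith G A F) (hB : IsModuleWith G B F) (hAne : A.Nonempty) (hBne : B.Nonempty) :
    ¬ Disjoint A B := by
  intro hAB
  have hAF := hA.disjoint hAne
  have hBF := hB.disjoint hBne
  obtain ⟨⟨s, hs⟩, ⟨t, ht⟩⟩ := hAne, hBne
  obtain ⟨c⟩ := h.colorable_induce_compl_singleton s
  obtain ⟨d⟩ := h.colorable_induce_compl_singleton t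
  refine h.not_colorable s ?_
  obtain ⟨⟨e⟩⟩ | ⟨⟨e⟩⟩ :=
    Function.Embedding.total ↥(d '' {u | ↑u ∈ F})ᶜ ↥(c '' {u | ↑u ∈ F})ᶜ
  · refine hA.nonempty_coloring ?_ ?_ c d e
    · simpa using hs
    · simpa using ⟨Set.disjoint_right.1 hAB ht, Set.disjoint_left.1 hBF ht⟩
  · refine hB.nonempty_coloring ?_ ?_ d c e
    · simpa using ht
    · simpa using ⟨Set.disjoint_left.1 hAB hs, Set.disjoint_left.1 hAF hs⟩

end IsVertexCritical

section Cells

variable {S : Set V}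

/-- The module attached to the vertex `s` of a maximal independent set `S`: `s` itself
together with the vertices whose only neighbour in `S` is `s`. -/
def cell (G : SimpleGraph V) (S : Set V) (s : S) : Set V :=
  {x | x = s ∨ trace G S x = {s}}

lemma disjoint_cell (hS : G.IsIndepSet S) {s t : S} (hst : s ≠ t) :
    Disjoint (cell G S s) (cell G S t) := by
  have not_trace : ∀ p q : S, trace G S p ≠ {q} := fun p q hpq =>
    not_adj_of_isIndepSet hS p q (hpq.ge rfl)
  refine Set.disjoint_left.2 ?_
  rintro x (rfl | hxs) (hx | hxt)
  · exact hst (Subtype.ext hx)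
  · exact not_trace s t hxt
  · exact not_trace t s (hx ▸ hxs)
  · exact hst (Set.singleton_injective (hxs.symm.trans hxt))

lemma not_adj_of_trace_eq_singleton (h₁ : IsIndFree coGem G) (hS : G.IsIndepSet S)
    (hcard : 3 ≤ S.encard) {x y : V} {s t : S} (hst : s ≠ t) (hx : trace G S x = {s})
    (hy : trace G S y = {t}) : ¬ G.Adj x y := by
  intro hxy
  have hindep := not_adj_of_isIndepSet hS
  have hx' (r : S) : G.Adj x r ↔ r = s := Set.ext_iff.1 hx r
  have hy' (r : S) : G.Adj y r ↔ r = t := Set.ext_iff.1 hy r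
  obtain ⟨r, hrs, hrt⟩ := ENat.exists_ne_ne_of_three_le hcard s t
  exact h₁ (coGem_isIndContained ((hx' s).2 rfl).symm hxy ((hy' t).2 rfl)
    (fun hsy => hst ((hy' s).1 hsy.symm)) (hindep s t) (fun hxt => hst ((hx' t).1 hxt).symm)
    (hindep s r) (fun hxr => hrs ((hx' r).1 hxr)) (fun hyr => hrt ((hy' r).1 hyr)) (hindep t r))

lemma adj_of_trace_eq_singleton (h : IsVertexCritical G k) (h₁ : IsIndFree coGem G)
    (h₂ : IsIndFree pawPlusPoint G) (hS : G.IsIndepSet S) (hcard : 3 ≤ S.encard)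
    (hdich : ∀ x ∉ S, trace G S x = Set.univ ∨ ∃ s, trace G S x = {s}) {x f : V} {s : S}
    (hx : trace G S x = {s}) (hf : trace G S f = Set.univ) : G.Adj x f := by
  by_contra hxf
  have hindep := not_adj_of_isIndepSet hS
  have hx' (p : S) : G.Adj x p ↔ p = s := Set.ext_iff.1 hx p
  have hf' (p : S) : G.Adj f p := hf.ge trivial
  obtain ⟨t, hts, -⟩ := ENat.exists_ne_ne_of_three_le hcard s s
  obtain ⟨r, hrs, hrt⟩ := ENat.exists_ne_ne_of_three_le hcard s t
  obtain ⟨w, hwt, hwr⟩ := h.exists_adj_not_adj (Subtype.coe_ne_coe.2 hrt.symm)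
  have hw : trace G S w = {t} := by
    rcases hdich w fun hwS => hindep ⟨w, hwS⟩ t hwt with hw | ⟨q, hw⟩
    · exact (hwr (hw.ge (Set.mem_univ r))).elim
    · rw [hw, (hw.le hwt : t = q)]
  have hws : ¬ G.Adj w s := fun hws => hts (hw.le hws).symm
  have hxw : ¬ G.Adj x w := not_adj_of_trace_eq_singleton h₁ hS hcard hts.symm hx hw
  have hxt : ¬ G.Adj x t := fun hxt => hts ((hx' t).1 hxt)
  have hxr : ¬ G.Adj x r := fun hxr => hrs ((hx' r).1 hxr)
  by_cases hwf : G.Adj w f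
  · exact h₂ (pawPlusPoint_isIndContained hwt (hf' t).symm hwf (hf' r) hwr (hindep t r)
      (hxw ∘ .symm) (hxt ∘ .symm) (hxf ∘ .symm) (hxr ∘ .symm))
  · exact h₁ (coGem_isIndContained ((hx' s).2 rfl) (hf' s).symm (hf' r) hxf hxr (hindep s r)
      hxw (hws ∘ .symm) (hwf ∘ .symm) (hwr ∘ .symm))

lemma isModuleWith_cell (h : IsVertexCritical G k) (h₁ : IsIndFree coGem G)
    (h₂ : IsIndFree pawPlusPoint G) (hS : G.IsIndepSet S) (hcard : 3 ≤ S.encard)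
    (hdich : ∀ x ∉ S, trace G S x = Set.univ ∨ ∃ s, trace G S x = {s}) (s : S) :
    IsModuleWith G (cell G S s) {f | trace G S f = Set.univ} := by
  have hindep := not_adj_of_isIndepSet hS
  intro a ha
  ext f
  constructor
  · rintro ⟨haf : G.Adj a f, hf⟩
    by_cases hfS : f ∈ S
    · rcases ha with rfl | ha
      · exact (hindep s ⟨f, hfS⟩ haf).elim
      · exact (hf (.inl (congrArg Subtype.val (ha.le haf : (⟨f, hfS⟩ : S) = s)))).elim
    refine (hdich f hfS).resolve_right ?_
    rintro ⟨q, hq⟩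
    have hqs : s ≠ q := by
      rintro rfl
      exact hf (.inr hq)
    rcases ha with rfl | ha
    · exact hqs (hq.le haf.symm)
    · exact not_adj_of_trace_eq_singleton h₁ hS hcard hqs ha hq haf
  · intro hf
    refine ⟨?_, ?_⟩
    · rcases ha with rfl | ha
      · exact SimpleGraph.Adj.symm (hf.ge trivial : s ∈ trace G S f)
      · exact adj_of_trace_eq_singleton h h₁ h₂ hS hcard hdich ha hf
    · rintro (rfl | hfs)
      · exact hindep s s (hf.ge trivial : s ∈ trace G S s)
      · obtain ⟨t, hts, -⟩ := ENat.exists_ne_ne_of_three_le hcard s s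
        exact hts ((hfs.symm.trans hf).ge (Set.mem_univ t))

end Cells

namespace IsVertexCritical

variable {S : Set V}

lemma encard_le_two_of_trace (h : IsVertexCritical G k) (h₁ : IsIndFree coGem G)
    (h₂ : IsIndFree pawPlusPoint G) (hS : G.IsIndepSet S)
    (hdich : ∀ x ∉ S, trace G S x = Set.univ ∨ ∃ s, trace G S x = {s}) : S.encard ≤ 2 := by
  by_contra! htwo
  have hcard : 3 ≤ S.encard := Order.add_one_le_of_lt htwo
  have hone : 1 < S.encard := lt_trans (mod_cast one_lt_two) htwo
  obtain ⟨s, hs, t, ht, hst⟩ := Set.one_lt_encard_iff_nontrivial.1 hone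
  have hmod := isModuleWith_cell h h₁ h₂ hS hcard hdich
  exact h.not_disjoint_of_isModuleWith (hmod ⟨s, hs⟩) (hmod ⟨t, ht⟩) ⟨s, .inl rfl⟩ ⟨t, .inl rfl⟩
    (disjoint_cell hS (Subtype.coe_ne_coe.1 hst))

lemma trace_dichotomy (h : IsVertexCritical G k) (h₁ : IsIndFree coGem G)
    (h₂ : IsIndFree pawPlusPoint G) (hS : Maximal G.IsIndepSet S) :
    (∀ x ∉ S, (trace G S x)ᶜ.Subsingleton) ∨
      ∀ x ∉ S, trace G S x = Set.univ ∨ ∃ s, trace G S x = {s} := by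
  have hdich := forall_subsingleton_compl_or_forall_eq_univ_or_singleton (𝒯 := trace G S '' Sᶜ)
  simp only [Set.forall_mem_image, Set.exists_mem_image, Set.mem_compl_iff] at hdich
  refine hdich (fun x hx => trace_nonempty_of_maximal hS hx) (fun s t hst => ?_)
    fun x _ y _ => trace_eq_or_disjoint h₁ h₂ hS.prop
  obtain ⟨x, hxs, hxt⟩ := h.exists_adj_not_adj (Subtype.coe_ne_coe.2 hst)
  exact ⟨x, fun hx => not_adj_of_isIndepSet hS.prop ⟨x, hx⟩ s hxs, hxs, hxt⟩

lemma encard_le_of_isIndepSet (h : IsVertexCritical G k) (h₁ : IsIndFree coGem G)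
    (h₂ : IsIndFree pawPlusPoint G) (hS : G.IsIndepSet S) : S.encard ≤ (max k 2 : ℕ) := by
  obtain ⟨T, hST, hT⟩ := exists_isIndepSet_subset_maximal hS
  refine (Set.encard_le_encard hST).trans ?_
  rcases h.trace_dichotomy h₁ h₂ hT with hco | hdich
  · exact (h.encard_le_of_subsingleton_compl_trace hT.prop hco).trans (mod_cast le_max_left k 2)
  · exact (h.encard_le_two_of_trace h₁ h₂ hT.prop hdich).trans (mod_cast le_max_right k 2)

lemma card_le (h : IsVertexCritical G k) (h₁ : IsIndFree coGem G)
    (h₂ : IsIndFree pawPlusPoint G) : ENat.card V ≤ (k * max k 2 : ℕ) := by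
  obtain ⟨c⟩ := h.colorable
  calc ENat.card V = (⋃ i, c.colorClass i).encard := by
        rw [Set.iUnion_eq_univ_iff.2 fun v => ⟨c v, rfl⟩, Set.encard_univ]
    _ ≤ ∑ i, (c.colorClass i).encard := Set.encard_iUnion_le_of_fintype _
    _ ≤ ∑ _ : Fin k, ((max k 2 : ℕ) : ℕ∞) := Finset.sum_le_sum fun i _ =>
        h.encard_le_of_isIndepSet h₁ h₂ (c.isIndepSet_colorClass i)
    _ = (k * max k 2 : ℕ) := by simp

end IsVertexCritical

end CriticalGraphs

theorem theorem4p1_general (k : ℕ) :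
    ∃ L : Finset (Σ n : ℕ, SimpleGraph (Fin n)),
      ∀ (V : Type*) (G : SimpleGraph V),
        IsVertexCritical G k → IsIndFree coGem G → IsIndFree pawPlusPoint G →
          ∃ F ∈ L, Nonempty (G ≃g F.2) := by
  classical
  refine ⟨(Finset.range (k * max k 2 + 1)).sigma fun _ => Finset.univ, fun V G h h₁ h₂ => ?_⟩
  have hcard := h.card_le h₁ h₂
  have : Finite V := ENat.card_lt_top.1 (hcard.trans_lt (ENat.natCast_lt_top _))
  let e := Finite.equivFin V
  refine ⟨⟨Nat.card V, G.map e.toEmbedding⟩, ?_, ⟨SimpleGraph.Iso.map e G⟩⟩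
  rw [ENat.card_eq_coe_natCard, Nat.cast_le] at hcard
  simpa using Nat.lt_succ_of_le hcard

theorem theorem4p1 (k : ℕ) :
    ∃ L : Finset (Σ n : ℕ, SimpleGraph (Fin n)),
      ∀ (V : Type*) [Finite V] (G : SimpleGraph V),
        IsVertexCritical G k → IsIndFree coGem G → IsIndFree pawPlusPoint G →
          ∃ F ∈ L, Nonempty (G ≃g F.2) := by
  obtain ⟨L, hL⟩ := theorem4p1_general k
  exact ⟨L, fun V _ => hL V⟩
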